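/- Let $b\in\mathbb{Q}\setminus\mathbb{Z}$ and $S=b+\mathbb{Z}$. A function $\pi\colon\mathbb{R}\to\mathbb{R}$ is a cut-generating function (CGF) for $S$ if for every $k\in\mathbb{N}$ and all $r_1,\dots,r_k\in\mathbb{R}$ one has $\sum_{i=1}^k\pi(r_i)y_i\ge 1$ for every $y\in\mathbb{Z}_{+}^k$ with $\sum_{i=1}^k r_iy_i\in S$. A CGF $\pi$ is strongly minimal if there are no CGF $\pi'\neq\pi$, real number $\beta\ge 0$ and inequality $\alpha x\ge\alpha_0$ ($\alpha,\alpha_0\in\mathbb{R}$) satisfied by all $x\in S$ such that $\beta\pi'(r)+\alpha r\le\pi(r)$ for all $r\in\mathbb{R}$ and $\beta+\alpha_0\ge 1$. A nonnegative CGF $\pi$ is extreme if there are no two distinct nonnegative CGFs $\pi_1,\pi_2$ for $S$ with $\pi=\frac{\pi_1+\pi_2}{2}$. A function is piecewise linear if $\mathbb{R}$ is a union of closed nondegenerate intervals, only finitely many of which meet any given bounded set, over each of which the function is affine; it is a 2-slope function if moreover its slopes take exactly two values. Theorem. Let $\bar\pi$ be a continuous strongly minimal function for $S$. Then for every $\varepsilon>0$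 there is an extreme 2-slope function $\pi^*$ for $S$, itself continuous and strongly minimal, such that $\sup_{r\in\mathbb{R}}|\bar\pi(r)-\pi^*(r)|\le\varepsilon$. In particular, the extreme functions are dense, in the sup norm, in the set of continuous strongly minimal functions for $S$. -/

import Mathlib

/-- `π` is a cut-generating function for `S ⊆ ℝ`: for all `k` and all `r₁, …, r_k ∈ ℝ`, the
inequality `∑ π(rᵢ) yᵢ ≥ 1` is valid for all `y ∈ ℤ₊^k` with `∑ rᵢ yᵢ ∈ S`. -/
def IsCGF (S : Set ℝ) (π : ℝ → ℝ) : Prop :=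
  ∀ (k : ℕ) (r : Fin k → ℝ) (y : Fin k → ℕ),
    (∑ i, r i * (y i : ℝ)) ∈ S → 1 ≤ ∑ i, π (r i) * (y i : ℝ)

/-- The inequality `α x ≥ α₀` is valid for `S`. -/
def ValidIneq (S : Set ℝ) (α α₀ : ℝ) : Prop :=
  ∀ s ∈ S, α₀ ≤ α * s

/-- `π` is a strongly minimal cut-generating function for `S`: it is not dominated by a different
cut-generating function, even up to scaling and adding a valid inequality for `S`. -/
def IsStronglyMinimal (S : Set ℝ) (π : ℝ → ℝ) : Prop :=
  IsCGF S π ∧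
    ¬ ∃ (π' : ℝ → ℝ) (β α α₀ : ℝ), IsCGF S π' ∧ π' ≠ π ∧ 0 ≤ β ∧ ValidIneq S α α₀ ∧
      (∀ r, β * π' r + α * r ≤ π r) ∧ 1 ≤ β + α₀

/-- A nonnegative cut-generating function (a valid function in the convention of Gomory and
Johnson). -/
def IsNonnegCGF (S : Set ℝ) (π : ℝ → ℝ) : Prop :=
  IsCGF S π ∧ ∀ r, 0 ≤ π r

/-- `π` is an extreme function for `S`: a nonnegative cut-generating function that is not the
midpoint of two distinct nonnegative cut-generating functions. (When `S = b + ℤ` with `b` rational,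
dropping the nonnegativity of the two functions would leave no extreme function at all: if
`f : ℝ → ℝ` is additive, nonzero and vanishes on `ℚ`, then `π + f` and `π - f` are cut-generating
functions whenever `π` is.) -/
def IsExtremeFunction (S : Set ℝ) (π : ℝ → ℝ) : Prop :=
  IsNonnegCGF S π ∧
    ¬ ∃ π₁ π₂ : ℝ → ℝ, IsNonnegCGF S π₁ ∧ IsNonnegCGF S π₂ ∧ π₁ ≠ π₂ ∧
      ∀ r, π r = (π₁ r + π₂ r) / 2

/-- `φ` is piecewise linear: `ℝ` is covered by closed nondegenerate intervals, only finitely many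
of which meet any given bounded set, such that `φ` is affine over each of them. -/
def IsPiecewiseLinear (φ : ℝ → ℝ) : Prop :=
  ∃ J : Set (Set ℝ),
    (∀ I ∈ J, I.OrdConnected ∧ IsClosed I ∧ I.Nontrivial) ∧
    ⋃₀ J = Set.univ ∧
    (∀ B : Set ℝ, Bornology.IsBounded B → {I ∈ J | (I ∩ B).Nonempty}.Finite) ∧
    ∀ I ∈ J, ∃ s c : ℝ, ∀ x ∈ I, φ x = s * x + c

/-- The set of slopes that `φ` takes over nondegenerate compact intervals on which it is affine. -/
def slopeSet (φ : ℝ → ℝ) : Set ℝ :=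
  {s | ∃ a b : ℝ, a < b ∧ ∃ c : ℝ, ∀ x ∈ Set.Icc a b, φ x = s * x + c}

/-- `φ` is a 2-slope function: piecewise linear, with exactly two slopes. -/
def IsTwoSlope (φ : ℝ → ℝ) : Prop :=
  IsPiecewiseLinear φ ∧ (slopeSet φ).ncard = 2

/-- The affine lattice `b + ℤ`. -/
def affineLattice (b : ℝ) : Set ℝ :=
  {s | ∃ z : ℤ, s = b + z}

/-! ### Cut-generating functions as inequalities over multisets -/

/-! A continuous minimal function is nonnegative, subadditive, `ℤ`-periodic, zero at `0`, and
satisfies `π r + π (b - r) = 1`. Conversely, all of these properties but nonnegativity already give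
strong minimality (`isStronglyMinimal_of_subadditive`). So it suffices to approximate within this
class by a 2-slope function and to show that such a function is extreme.

Approximation (`exists_isTwoSlopeGrid`): on a fine grid `(1/N)ℤ` containing `b`, replace `π` by `ψ =
(1 - l) π + l / 2`, which is subadditive with slack `l / 2`. Round `M ψ(n) + n / 2` to integers `P
n`. The slack absorbs the rounding errors, and uniform continuity makes `P` increase by `0` or `1`
per step, so `(2 P n - n) / (2 M)` has steps `±1 / (2 M)`. The one defect is that `P 0` is not `0`.
It is repaired by clamping `P` between an envelope `C = capFun` with `C 0 = 0` and the mirror image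
of `C` under `n ↦ B - n` (`exists_clamped_function`). Interpolation between grid points preserves
subadditivity and symmetry.

Extremality (`IsTwoSlopeGrid.eq_of_additive`) is the Gomory–Johnson two-slope argument: if the
function is the midpoint of two nonnegative cut-generating functions, each of them inherits its
additivity relations. These force linearity on both sides of `0`, and then propagate the two slopes
over all cells; the values at `1` and `b` fix the remaining two parameters. -/

theorem isCGF_iff_multiset {S : Set ℝ} {π : ℝ → ℝ} :
    IsCGF S π ↔ ∀ M : Multiset ℝ, M.sum ∈ S → 1 ≤ (M.map π).sum := by
  constructor
  · intro h M hM
    induction M using Quotient.inductionOn with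
    | h l =>
      have := h l.length (fun i => l.get i) (fun _ => 1)
      simp only [Nat.cast_one, mul_one, List.get_eq_getElem] at this
      have h1 : (∑ i : Fin l.length, l[i.1]) = l.sum := by
        simp
      have h2 : (∑ i : Fin l.length, π l[i.1]) = (l.map π).sum := Fin.sum_univ_fun_getElem l π
      rw [h1, h2] at this
      simpa using this (by simpa using hM)
  · intro h k r y hS
    have := h (∑ i, y i • ({r i} : Multiset ℝ)) (by
      simpa [Multiset.sum_sum, Multiset.sum_nsmul, mul_comm] using hS)
    have e : (Multiset.map π (∑ i, y i • ({r i} : Multiset ℝ))).sum = ∑ i, π (r i) * (y i : ℝ) := by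
      rw [← Multiset.coe_mapAddMonoidHom, map_sum, Multiset.sum_sum]
      simp [Multiset.map_nsmul, Multiset.sum_nsmul, mul_comm]
    rwa [e] at this

theorem affineLattice_add_int {b x : ℝ} (z : ℤ) (hx : x ∈ affineLattice b) :
    x + z ∈ affineLattice b := by
  obtain ⟨w, rfl⟩ := hx
  exact ⟨w + z, by push_cast; ring⟩

theorem self_mem_affineLattice (b : ℝ) : b ∈ affineLattice b := ⟨0, by simp⟩

/-- `π` is a pointwise minimal cut-generating function. -/
def IsMinimalCGF (S : Set ℝ) (π : ℝ → ℝ) : Prop :=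
  IsCGF S π ∧ ∀ π' : ℝ → ℝ, IsCGF S π' → (∀ r, π' r ≤ π r) → π' = π

theorem IsStronglyMinimal.isMinimalCGF {b : ℝ} {π : ℝ → ℝ}
    (h : IsStronglyMinimal (affineLattice b) π) : IsMinimalCGF (affineLattice b) π := by
  refine ⟨h.1, fun π' hπ' hle => ?_⟩
  by_contra hne
  exact h.2 ⟨π', 1, 0, 0, hπ', hne, zero_le_one, fun s _ => by simp, by simpa using hle, by simp⟩

/-- Because `b + ℤ` is unbounded in both directions, no nonconstant linear form is bounded below on
it. Strong minimality therefore involves only scaling. -/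
theorem ValidIneq.eq_zero {b α α₀ : ℝ} (h : ValidIneq (affineLattice b) α α₀) :
    α = 0 ∧ α₀ ≤ 0 := by
  have hα : α = 0 := by
    by_contra hne
    have key : ∀ z : ℤ, α₀ ≤ α * (b + z) := fun z => h _ ⟨z, rfl⟩
    obtain ⟨n, hn⟩ := exists_int_lt ((α₀ - α * b) / α)
    obtain ⟨m, hm⟩ := exists_int_gt ((α₀ - α * b) / α)
    rcases lt_or_gt_of_ne hne with hneg | hpos
    · have := key m
      rw [div_lt_iff_of_neg hneg] at hm
      nlinarith
    · have := key n
      rw [lt_div_iff₀ hpos] at hn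
      nlinarith
  refine ⟨hα, ?_⟩
  simpa [hα] using h b (self_mem_affineLattice b)

namespace IsCGF

variable {b : ℝ} {π : ℝ → ℝ}

theorem one_le_of_mem {S : Set ℝ} (h : IsCGF S π) (hb : b ∈ S) : 1 ≤ π b := by
  simpa using isCGF_iff_multiset.1 h {b} (by simpa using hb)

theorem one_le_add (h : IsCGF (affineLattice b) π) (r : ℝ) : 1 ≤ π r + π (b - r) := by
  simpa using isCGF_iff_multiset.1 h {r, b - r} (by simpa using self_mem_affineLattice b)

theorem map_zero_nonneg (h : IsCGF (affineLattice b) π) : 0 ≤ π 0 := by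
  by_contra! hneg
  obtain ⟨k, hk⟩ := exists_nat_gt ((π b - 1) / -π 0)
  have := isCGF_iff_multiset.1 h (b ::ₘ Multiset.replicate k 0)
    (by simpa using self_mem_affineLattice b)
  rw [div_lt_iff₀ (by linarith)] at hk
  simp at this
  linarith

end IsCGF

namespace IsMinimalCGF

variable {b : ℝ} {π : ℝ → ℝ}

/-- If this failed, `π x` could be lowered to the sum over `N`: in any multiset each copy of `x` can
be exchanged for `N`, which shifts the total by an integer and so stays in `b + ℤ`. Subadditivity,
periodicity and `π 0 ≤ 0` are all special cases. -/
theorem le_sum_map (h : IsMinimalCGF (affineLattice b) π) (x : ℝ) (N : Multiset ℝ) (z : ℤ)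
    (hN : N.sum = x + z) : π x ≤ (N.map π).sum := by
  by_contra! hlt
  have hcgf : IsCGF (affineLattice b) (Function.update π x (N.map π).sum) := by
    rw [isCGF_iff_multiset]
    intro M hM
    have key : ∃ (M' : Multiset ℝ) (w : ℤ), M'.sum = M.sum + w ∧
        (M'.map π).sum = (M.map (Function.update π x (N.map π).sum)).sum := by
      clear hM
      induction M using Multiset.induction with
      | empty => exact ⟨0, 0, by simp⟩
      | cons a M ih =>
        obtain ⟨M', w, h1, h2⟩ := ih
        by_cases ha : a = x
        · refine ⟨N + M', z + w, ?_, ?_⟩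
          · simp [hN, h1, ha]; ring
          · simp [h2, ha]
        · refine ⟨a ::ₘ M', w, ?_, ?_⟩
          · simp [h1]; ring
          · simp [h2, ha]
    obtain ⟨M', w, h1, h2⟩ := key
    rw [← h2]
    exact isCGF_iff_multiset.1 h.1 M' (h1 ▸ affineLattice_add_int w hM)
  have := h.2 _ hcgf (fun r => by
    by_cases hr : r = x
    · subst hr; simpa using hlt.le
    · simp [hr])
  have := congrFun this x
  simp at this
  linarith

theorem map_zero (h : IsMinimalCGF (affineLattice b) π) : π 0 = 0 :=
  le_antisymm (by simpa using h.le_sum_map 0 0 0 (by simp)) h.1.map_zero_nonneg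

theorem subadditive (h : IsMinimalCGF (affineLattice b) π) (x y : ℝ) : π (x + y) ≤ π x + π y := by
  simpa using h.le_sum_map (x + y) {x, y} 0 (by simp)

theorem map_add_int (h : IsMinimalCGF (affineLattice b) π) (x : ℝ) (z : ℤ) : π (x + z) = π x := by
  apply le_antisymm
  · simpa using h.le_sum_map (x + z) {x} (-z) (by simp)
  · simpa using h.le_sum_map x {x + z} z (by simp)

theorem nonneg_of_continuous (h : IsMinimalCGF (affineLattice b) π) (hc : Continuous π) (x : ℝ) :
    0 ≤ π x := by
  refine Rat.denseRange_cast.induction_on (p := fun x : ℝ => 0 ≤ π x) x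
    (isClosed_le continuous_const hc) (fun q => ?_)
  have hq := h.le_sum_map 0 (Multiset.replicate q.den (q : ℝ)) q.num (by
    rw [Multiset.sum_replicate, nsmul_eq_mul, zero_add]
    exact_mod_cast Rat.den_mul_eq_num q)
  rw [h.map_zero, Multiset.map_replicate, Multiset.sum_replicate, nsmul_eq_mul] at hq
  exact nonneg_of_mul_nonneg_right hq (by exact_mod_cast q.den_pos)

/-- Otherwise the value at `r` alone can be divided by `c = π r + π (b - r) > 1`. A multiset
containing `r` had `π`-sum at least `c`, so even dividing every term by `c` leaves at least `1`; the
other multisets are unaffected. -/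
theorem add_le_one_of_pos (h : IsMinimalCGF (affineLattice b) π) (hnn : ∀ x, 0 ≤ π x)
    {r : ℝ} (hr : 0 < π r) : π r + π (b - r) ≤ 1 := by
  by_contra! hgt
  set c := π r + π (b - r) with hc
  have hc0 : 0 < c := by linarith
  have hlt : π r / c < π r := div_lt_self hr hgt
  have hge : ∀ x, π x / c ≤ Function.update π r (π r / c) x := fun x => by
    by_cases hx : x = r
    · simp [hx]
    · simpa [hx] using div_le_self (hnn x) hgt.le
  have hcgf : IsCGF (affineLattice b) (Function.update π r (π r / c)) := by
    rw [isCGF_iff_multiset]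
    intro M hM
    by_cases hrM : r ∈ M
    · obtain ⟨M₀, rfl⟩ := Multiset.exists_cons_of_mem hrM
      have h1 : π (b - r) ≤ (M₀.map π).sum := by
        obtain ⟨z, hz⟩ := hM
        refine h.le_sum_map _ _ z ?_
        simp at hz
        linarith
      calc (1 : ℝ) ≤ ((r ::ₘ M₀).map π).sum / c := by
            rw [le_div_iff₀ hc0]; simp; linarith
        _ = ((r ::ₘ M₀).map (fun x => π x / c)).sum := by
            rw [Multiset.sum_map_div]
        _ ≤ _ := Multiset.sum_map_le_sum_map _ _ (fun x _ => hge x)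
    · rw [Multiset.map_congr rfl (g := π)
        (fun x hx => Function.update_of_ne (fun e => hrM (by rwa [← e])) _ _)]
      exact isCGF_iff_multiset.1 h.1 M hM
  have := congrFun (h.2 _ hcgf (fun x => by
    by_cases hx : x = r
    · subst hx; simpa using hlt.le
    · simp [hx])) r
  simp at this
  exact hlt.ne this

theorem add_map_sub (h : IsMinimalCGF (affineLattice b) π) (hnn : ∀ x, 0 ≤ π x) (r : ℝ) :
    π r + π (b - r) = 1 := by
  refine le_antisymm ?_ (h.1.one_le_add r)
  rcases (hnn r).lt_or_eq with hr | hr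
  · exact h.add_le_one_of_pos hnn hr
  · have h1 := h.1.one_le_add r
    have := h.add_le_one_of_pos hnn (r := b - r) (by linarith)
    rwa [sub_sub_cancel, add_comm] at this

end IsMinimalCGF

theorem isStronglyMinimal_of_subadditive {b : ℝ} {π : ℝ → ℝ} (h0 : π 0 = 0)
    (hsub : ∀ x y, π (x + y) ≤ π x + π y) (hper : ∀ (x : ℝ) (z : ℤ), π (x + z) = π x)
    (hsymm : ∀ r, π r + π (b - r) = 1) : IsStronglyMinimal (affineLattice b) π := by
  have hb : π b = 1 := by simpa [h0] using hsymm 0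
  constructor
  · rw [isCGF_iff_multiset]
    rintro M ⟨z, hz⟩
    have : π M.sum ≤ (M.map π).sum := Multiset.le_sum_of_subadditive π h0.le hsub M
    rwa [hz, hper, hb] at this
  · rintro ⟨π', β, α, α₀, hcgf, hne, hβ, hval, hle, h1⟩
    obtain ⟨rfl, hα₀⟩ := hval.eq_zero
    -- Adding the domination at `0` and `b` gives `β ≤ β (π' 0 + π' b) ≤ 1`, while `α₀ ≤ 0` gives `β
    -- ≥ 1`.
    have hβ1 : β = 1 := by
      have := hcgf.one_le_add 0
      have e1 := hle 0
      have e2 := hle (b - 0)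
      have e3 := hsymm 0
      nlinarith
    subst hβ1
    refine hne (funext fun r => ?_)
    have := hcgf.one_le_add r
    have e1 := hle r
    have e2 := hle (b - r)
    have e3 := hsymm r
    linarith

/-! ### Linear interpolation of functions on the integers -/

/-- The piecewise linear interpolation of a function on the integers. -/
noncomputable def interp (F : ℤ → ℝ) (y : ℝ) : ℝ :=
  F ⌊y⌋ + (y - ⌊y⌋) * (F (⌊y⌋ + 1) - F ⌊y⌋)

section interp

variable {F : ℤ → ℝ}

@[simp] theorem interp_intCast (n : ℤ) : interp F n = F n := by simp [interp]

theorem interp_eq {y : ℝ} (n : ℤ) (h1 : n ≤ y) (h2 : y ≤ n + 1) :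
    interp F y = F n + (y - n) * (F (n + 1) - F n) := by
  rcases h2.lt_or_eq with h2 | rfl
  · have : ⌊y⌋ = n := Int.floor_eq_iff.2 ⟨h1, h2⟩
    rw [interp, this]
  · have := interp_intCast (F := F) (n + 1)
    push_cast at this
    rw [this]
    ring

theorem interp_add_int {N : ℤ} (hF : ∀ n, F (n + N) = F n) (y : ℝ) :
    interp F (y + N) = interp F y := by
  have h := hF (⌊y⌋ + 1)
  rw [add_right_comm] at h
  rw [interp, Int.floor_add_intCast, hF, h, interp]
  push_cast
  ring

theorem interp_add_sub {B : ℤ} {c : ℝ} (hF : ∀ n, F n + F (B - n) = c) (y : ℝ) :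
    interp F y + interp F (B - y) = c := by
  have h1 := Int.floor_le y
  have h2 := Int.lt_floor_add_one y
  rw [interp_eq ⌊y⌋ h1 h2.le, interp_eq (F := F) (y := B - y) (B - (⌊y⌋ + 1))
    (by push_cast; linarith) (by push_cast; linarith)]
  have e1 := hF ⌊y⌋
  have e2 := hF (⌊y⌋ + 1)
  have e : B - (⌊y⌋ + 1) + 1 = B - ⌊y⌋ := by ring
  rw [e]
  have e3 : F (B - ⌊y⌋) = c - F ⌊y⌋ := by linarith
  have e4 : F (B - (⌊y⌋ + 1)) = c - F (⌊y⌋ + 1) := by linarith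
  rw [e3, e4]
  push_cast
  ring

/-- The diagonal `t + u = 1` cuts each unit square into two triangles on which both sides are
affine, so the inequality is a convex combination of those at the vertices. -/
theorem interp_subadditive (hF : ∀ m n, F (m + n) ≤ F m + F n) (x y : ℝ) :
    interp F (x + y) ≤ interp F x + interp F y := by
  have hx1 := Int.floor_le x
  have hx2 := Int.lt_floor_add_one x
  have hy1 := Int.floor_le y
  have hy2 := Int.lt_floor_add_one y
  rw [interp_eq ⌊x⌋ hx1 hx2.le, interp_eq ⌊y⌋ hy1 hy2.le]
  generalize ⌊x⌋ = m at *
  generalize ⌊y⌋ = n at *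
  obtain ⟨t, rfl⟩ : ∃ t, x = m + t := ⟨x - m, by ring⟩
  obtain ⟨u, rfl⟩ : ∃ u, y = n + u := ⟨y - n, by ring⟩
  have h10 := hF (m + 1) n
  have h01 := hF m (n + 1)
  rw [add_right_comm] at h10
  rw [← add_assoc] at h01
  rcases le_total (t + u) 1 with h | h
  · rw [interp_eq (F := F) (m + n) (by push_cast; linarith) (by push_cast; linarith)]
    have h00 := mul_le_mul_of_nonneg_left (hF m n) (by linarith : 0 ≤ 1 - t - u)
    have h10 := mul_le_mul_of_nonneg_left h10 (by linarith : 0 ≤ t)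
    have h01 := mul_le_mul_of_nonneg_left h01 (by linarith : 0 ≤ u)
    push_cast
    linarith
  · rw [interp_eq (F := F) (m + n + 1) (by push_cast; linarith) (by push_cast; linarith)]
    have h11 := hF (m + 1) (n + 1)
    rw [show m + 1 + (n + 1) = m + n + 1 + 1 by ring] at h11
    have h11 := mul_le_mul_of_nonneg_left h11 (by linarith : 0 ≤ t + u - 1)
    have h10 := mul_le_mul_of_nonneg_left h10 (by linarith : 0 ≤ 1 - u)
    have h01 := mul_le_mul_of_nonneg_left h01 (by linarith : 0 ≤ 1 - t)
    push_cast
    linarith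

theorem abs_sub_interp_le {y c η : ℝ} (h1 : |c - F ⌊y⌋| ≤ η) (h2 : |c - F (⌊y⌋ + 1)| ≤ η) :
    |c - interp F y| ≤ η := by
  have hy1 := Int.floor_le y
  have hy2 := Int.lt_floor_add_one y
  rw [abs_le] at *
  rw [interp]
  constructor <;> nlinarith

theorem interp_nonneg (hF : ∀ n, 0 ≤ F n) (y : ℝ) : 0 ≤ interp F y := by
  have hy1 := Int.floor_le y
  have hy2 := Int.lt_floor_add_one y
  have := hF ⌊y⌋
  have := hF (⌊y⌋ + 1)
  rw [interp]
  nlinarith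

end interp

theorem IsPiecewiseLinear.interp_comp_mul (F : ℤ → ℝ) {N : ℝ} (hN : 0 < N) :
    IsPiecewiseLinear (fun x => interp F (N * x)) := by
  refine ⟨Set.range fun n : ℤ => Set.Icc (n / N) ((n + 1) / N), ?_, ?_, ?_, ?_⟩
  · rintro _ ⟨n, rfl⟩
    refine ⟨Set.ordConnected_Icc, isClosed_Icc, ?_⟩
    have : (n : ℝ) / N < (n + 1) / N := by gcongr; linarith
    exact Set.nontrivial_of_mem_mem_ne (Set.left_mem_Icc.2 this.le) (Set.right_mem_Icc.2 this.le)
      this.ne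
  · refine Set.eq_univ_of_forall fun x => ⟨_, ⟨⌊N * x⌋, rfl⟩, ?_, ?_⟩
    · rw [div_le_iff₀ hN, mul_comm]; exact Int.floor_le _
    · rw [le_div_iff₀ hN, mul_comm]; exact (Int.lt_floor_add_one _).le
  · intro B hB
    obtain ⟨R, hR⟩ := hB.subset_closedBall 0
    refine ((Set.finite_Icc (-⌈N * R⌉ - 1) ⌈N * R⌉).image
      fun n : ℤ => Set.Icc (n / N) ((n + 1) / N)).subset ?_
    rintro _ ⟨⟨n, rfl⟩, x, ⟨hx1, hx2⟩, hxB⟩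
    refine ⟨n, ?_, rfl⟩
    have hx := hR hxB
    rw [Metric.mem_closedBall, Real.dist_eq, sub_zero, abs_le] at hx
    rw [div_le_iff₀ hN] at hx1
    rw [le_div_iff₀ hN] at hx2
    have hc := Int.le_ceil (N * R)
    constructor
    · have : (-⌈N * R⌉ - 1 : ℝ) ≤ n := by nlinarith
      exact_mod_cast this
    · have : (n : ℝ) ≤ ⌈N * R⌉ := by nlinarith
      exact_mod_cast this
  · rintro _ ⟨n, rfl⟩
    refine ⟨N * (F (n + 1) - F n), F n - n * (F (n + 1) - F n), fun x ⟨hx1, hx2⟩ => ?_⟩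
    rw [div_le_iff₀ hN] at hx1
    rw [le_div_iff₀ hN] at hx2
    dsimp only
    rw [interp_eq n (by linarith) (by linarith)]
    ring

/-- The oscillation of a subadditive function is controlled by its values near `0`. -/
theorem abs_sub_lt_of_subadditive {π : ℝ → ℝ} (hsub : ∀ x y, π (x + y) ≤ π x + π y) {δ ε : ℝ}
    (h : ∀ t, |t| < δ → π t < ε) (x y : ℝ) (hxy : |x - y| < δ) : |π x - π y| < ε := by
  have h1 := hsub (x - y) y
  have h2 := hsub (y - x) x
  rw [sub_add_cancel] at h1 h2
  have h3 := h _ hxy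
  have h4 := h (y - x) (by rwa [abs_sub_comm])
  rw [abs_lt]
  constructor <;> linarith

/-- A bounded function that is additive on `[0, δ]` and vanishes at `δ` is zero on `[0, δ]`. -/
theorem eq_zero_of_additive_of_bounded {E : ℝ → ℝ} {δ C : ℝ}
    (hadd : ∀ u v, 0 ≤ u → 0 ≤ v → u + v ≤ δ → E (u + v) = E u + E v)
    (hδ : E δ = 0) (hC : ∀ u, 0 ≤ u → u ≤ δ → |E u| ≤ C) {u : ℝ} (hu : 0 ≤ u) (huδ : u ≤ δ) :
    E u = 0 := by
  -- Doubling halves the bound on `[0, δ/2]`, and `E u = -E (δ - u)` carries it to the other half.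
  have half : ∀ C : ℝ, (∀ u, 0 ≤ u → u ≤ δ → |E u| ≤ C) →
      ∀ u, 0 ≤ u → u ≤ δ → |E u| ≤ C / 2 := by
    intro C hC u hu huδ
    have small : ∀ u, 0 ≤ u → u ≤ δ / 2 → |E u| ≤ C / 2 := fun u hu huδ => by
      have h1 := hadd u u hu hu (by linarith)
      have h2 := hC (u + u) (by linarith) (by linarith)
      rw [h1, ← two_mul, abs_mul, abs_two] at h2
      linarith
    rcases le_total u (δ / 2) with h | h
    · exact small u hu h
    · have h1 := hadd u (δ - u) hu (by linarith) (by linarith)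
      rw [add_sub_cancel, hδ] at h1
      rw [show E u = -E (δ - u) by linarith, abs_neg]
      exact small _ (by linarith) (by linarith)
  have key : ∀ k : ℕ, ∀ u, 0 ≤ u → u ≤ δ → |E u| ≤ C * (1 / 2) ^ k := by
    intro k
    induction k with
    | zero => simpa using hC
    | succ k ih =>
      intro u hu huδ
      have := half _ ih u hu huδ
      rwa [pow_succ, ← mul_assoc, mul_one_div]
  have lim : Filter.Tendsto (fun k : ℕ => C * (1 / 2 : ℝ) ^ k) Filter.atTop (nhds (C * 0)) :=
    (tendsto_pow_atTop_nhds_zero_of_lt_one (by norm_num) (by norm_num)).const_mul C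
  rw [mul_zero] at lim
  exact abs_nonpos_iff.1 (ge_of_tendsto' lim fun k => key k u hu huδ)

/-! ### Two-slope functions with breakpoints on a grid -/

/-- The data of a 2-slope function with breakpoints in `(1/N)ℤ`: its values `F n` at the points
`n / N`, which change by `±η` in each step, and which make it minimal for `B / N + ℤ`. -/
structure IsTwoSlopeGrid (N B : ℤ) (η : ℝ) (F : ℤ → ℝ) : Prop where
  N_pos : 0 < N
  η_pos : 0 < η
  map_zero : F 0 = 0
  map_one : F 1 = η
  map_neg_one : F (-1) = η
  step : ∀ n, F (n + 1) = F n + η ∨ F (n + 1) = F n - η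
  nonneg : ∀ n, 0 ≤ F n
  subadditive : ∀ m n, F (m + n) ≤ F m + F n
  periodic : ∀ n, F (n + N) = F n
  symm : ∀ n, F n + F (B - n) = 1

namespace IsTwoSlopeGrid

variable {N B : ℤ} {η b : ℝ} {F : ℤ → ℝ}

theorem N_pos' (h : IsTwoSlopeGrid N B η F) : (0 : ℝ) < N := by exact_mod_cast h.N_pos

theorem periodic_mul (h : IsTwoSlopeGrid N B η F) (z n : ℤ) : F (n + N * z) = F n := by
  have : Function.Periodic F N := h.periodic
  simpa [mul_comm] using this.int_mul z n

theorem isStronglyMinimal (h : IsTwoSlopeGrid N B η F) (hb : N * b = B) :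
    IsStronglyMinimal (affineLattice b) (fun x => interp F (N * x)) := by
  refine isStronglyMinimal_of_subadditive ?_ (fun x y => ?_) (fun x z => ?_) (fun r => ?_)
  · simpa [h.map_zero] using interp_intCast (F := F) 0
  · rw [mul_add]
    exact interp_subadditive h.subadditive _ _
  · rw [mul_add]
    exact_mod_cast interp_add_int (fun n => h.periodic_mul z n) (N * x)
  · rw [mul_sub, hb]
    exact interp_add_sub h.symm _

theorem interp_nonneg (h : IsTwoSlopeGrid N B η F) (x : ℝ) : 0 ≤ interp F x :=
  _root_.interp_nonneg h.nonneg x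

theorem interp_of_mem_Icc (h : IsTwoSlopeGrid N B η F) {y : ℝ} (h0 : 0 ≤ y) (h1 : y ≤ 1) :
    interp F y = η * y := by
  rw [interp_eq 0 (by simpa) (by simpa)]
  simp [h.map_zero, h.map_one, mul_comm]

theorem interp_neg_of_mem_Icc (h : IsTwoSlopeGrid N B η F) {y : ℝ} (h0 : 0 ≤ y) (h1 : y ≤ 1) :
    interp F (-y) = η * y := by
  rw [interp_eq (-1) (by simpa) (by simpa)]
  simp [h.map_zero, h.map_neg_one]
  ring

theorem continuous (h : IsTwoSlopeGrid N B η F) : Continuous (fun x => interp F (N * x)) := by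
  have hN := h.N_pos'
  suffices hc : Continuous (interp F) from hc.comp (continuous_const_mul _)
  refine Metric.continuous_iff.2 fun x ε hε => ⟨min 1 (ε / η), lt_min one_pos (div_pos hε h.η_pos),
    fun y hy => ?_⟩
  refine abs_sub_lt_of_subadditive (interp_subadditive h.subadditive) (fun t ht => ?_) y x hy
  have h1 := ht.trans_le (min_le_left _ _)
  have h2 := ht.trans_le (min_le_right _ _)
  rw [lt_div_iff₀ h.η_pos] at h2
  rcases le_total 0 t with h0 | h0
  · rw [abs_of_nonneg h0] at h1 h2
    rw [h.interp_of_mem_Icc h0 h1.le]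
    linarith
  · rw [abs_of_nonpos h0] at h1 h2
    have := h.interp_neg_of_mem_Icc (neg_nonneg.2 h0) h1.le
    rw [neg_neg] at this
    rw [this]
    linarith

theorem slopeSet_eq (h : IsTwoSlopeGrid N B η F) :
    slopeSet (fun x => interp F (N * x)) = {N * η, -(N * η)} := by
  have hN := h.N_pos'
  ext s
  constructor
  · rintro ⟨u, v, huv, c, hc⟩
    have h1 := Int.floor_le (N * u)
    have h2 := Int.lt_floor_add_one (N * u)
    set n := ⌊N * u⌋
    set w := min v ((n + 1) / N) with hw
    have huw : u < w := lt_min huv (by rw [lt_div_iff₀ hN]; linarith)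
    have hwn : N * w ≤ n + 1 := by
      have := min_le_right v ((n + 1) / N)
      rw [← hw, le_div_iff₀ hN] at this
      linarith
    have e1 := hc u ⟨le_rfl, huv.le⟩
    have e2 := hc w ⟨huw.le, min_le_left _ _⟩
    beta_reduce at e1 e2
    have huw' : N * u < N * w := by gcongr
    rw [interp_eq n h1 h2.le] at e1
    rw [interp_eq n (by linarith) hwn] at e2
    have e : (w - u) * (N * (F (n + 1) - F n)) = (w - u) * s := by linarith
    have e := mul_left_cancel₀ (sub_pos.2 huw).ne' e
    rw [← e]
    rcases h.step n with hs | hs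
    · left; rw [hs]; ring
    · right; rw [Set.mem_singleton_iff, hs]; ring
  · rintro (rfl | rfl)
    · refine ⟨0, 1 / N, by positivity, 0, fun x ⟨hx0, hx1⟩ => ?_⟩
      rw [le_div_iff₀ hN] at hx1
      dsimp only
      rw [h.interp_of_mem_Icc (by positivity) (by linarith)]
      ring
    · refine ⟨-(1 / N), 0, by simpa using hN, 0, fun x ⟨hx0, hx1⟩ => ?_⟩
      rw [neg_le, le_div_iff₀ hN] at hx0
      have := h.interp_neg_of_mem_Icc (y := N * -x) (mul_nonneg hN.le (neg_nonneg.2 hx1))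
        (by linarith)
      dsimp only
      rw [show N * x = -(N * -x) by ring, this]
      ring

theorem isTwoSlope (h : IsTwoSlopeGrid N B η F) : IsTwoSlope (fun x => interp F (N * x)) := by
  refine ⟨IsPiecewiseLinear.interp_comp_mul F h.N_pos', ?_⟩
  rw [h.slopeSet_eq]
  have := mul_pos h.N_pos' h.η_pos
  exact Set.ncard_pair (by linarith)

/-- A function that inherits the additivities of a 2-slope function is a multiple of it, up to a
linear function. -/
theorem eq_of_additive (h : IsTwoSlopeGrid N B η F) (hb : N * b = B) {π : ℝ → ℝ}
    (hadd : ∀ u v, interp F (N * (u + v)) = interp F (N * u) + interp F (N * v) →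
      π (u + v) = π u + π v)
    (hnn : ∀ x, 0 ≤ π x) (h0 : π 0 = 0) (h1 : π 1 = 0) (hb1 : π b = 1) (x : ℝ) :
    π x = interp F (N * x) := by
  have hN := h.N_pos'
  have hη := h.η_pos
  -- Nonnegativity and additivity bound `ρ` by `ρ (1 / N)`, which rules out wild solutions of
  -- Cauchy's equation.
  have lin : ∀ ρ : ℝ → ℝ, (∀ x, 0 ≤ ρ x) →
      (∀ u v : ℝ, 0 ≤ u → 0 ≤ v → u + v ≤ 1 / N → ρ (u + v) = ρ u + ρ v) →
      ∀ u : ℝ, 0 ≤ u → u ≤ 1 / N → ρ u = N * ρ (1 / N) * u := by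
    intro ρ hρ hρadd u hu hu1
    have hle : ∀ u : ℝ, 0 ≤ u → u ≤ 1 / N → ρ u ≤ ρ (1 / N) := fun u hu hu1 => by
      have := hρadd u (1 / N - u) hu (by linarith) (by linarith)
      rw [add_sub_cancel] at this
      linarith [hρ (1 / N - u)]
    have := eq_zero_of_additive_of_bounded (E := fun u => ρ u - N * ρ (1 / N) * u)
      (δ := 1 / N) (C := ρ (1 / N)) (fun u v hu hv huv => by
        rw [hρadd u v hu hv huv]
        ring) (by field_simp; ring) (fun u hu hu1 => by
        have e1 := hle u hu hu1
        have e2 := hρ u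
        have e3 : N * ρ (1 / N) * u ≤ ρ (1 / N) := by
          rw [le_div_iff₀ hN] at hu1
          nlinarith [hρ (1 / N)]
        have e4 : 0 ≤ N * ρ (1 / N) * u := mul_nonneg (mul_nonneg hN.le (hρ _)) hu
        rw [abs_le]
        constructor <;> linarith) hu hu1
    linarith
  have lin_pos := lin π hnn fun u v hu hv huv => by
    rw [le_div_iff₀ hN] at huv
    apply hadd
    have hu' : 0 ≤ N * u := by positivity
    have hv' : 0 ≤ N * v := by positivity
    rw [h.interp_of_mem_Icc (by positivity) (by linarith), h.interp_of_mem_Icc hu' (by linarith),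
      h.interp_of_mem_Icc hv' (by linarith)]
    ring
  have lin_neg := lin (fun x => π (-x)) (fun x => hnn _) fun u v hu hv huv => by
    rw [le_div_iff₀ hN] at huv
    rw [neg_add]
    apply hadd
    have hu' : 0 ≤ N * u := by positivity
    have hv' : 0 ≤ N * v := by positivity
    rw [← neg_add, mul_neg, mul_neg, mul_neg, h.interp_neg_of_mem_Icc (by positivity) (by linarith),
      h.interp_neg_of_mem_Icc hu' (by linarith), h.interp_neg_of_mem_Icc hv' (by linarith)]
    ring
  -- `p` and `q` are chosen so that `p x + q F(N x)` has the same one-sided slopes at `0` as `π`.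
  obtain ⟨p, q, hp, hq⟩ : ∃ p q : ℝ, N * π (1 / N) = p + q * (N * η) ∧
      N * π (-(1 / N)) = -p + q * (N * η) :=
    ⟨(N * π (1 / N) - N * π (-(1 / N))) / 2, (π (1 / N) + π (-(1 / N))) / (2 * η),
      by field_simp; ring, by field_simp; ring⟩
  rw [hp] at lin_pos
  rw [hq] at lin_neg
  -- The error is constant on each cell. On an ascending cell `F` is additive at its left endpoint
  -- plus a small positive step, on a descending one at its right endpoint plus a small negative
  -- step.
  have cell : ∀ n : ℤ, ∀ t, 0 ≤ t → t ≤ 1 →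
      π ((n + t) / N) - p * ((n + t) / N) - q * interp F (n + t) =
        π (n / N) - p * (n / N) - q * interp F n := by
    have up : ∀ (n : ℤ) t, F (n + 1) = F n + η → 0 ≤ t → t ≤ 1 →
        π ((n + t) / N) = π (n / N) + (p + q * (N * η)) * (t / N) ∧
          interp F (n + t) = interp F n + η * t := by
      intro n t hs ht ht1
      have e : interp F (n + t) = interp F n + η * t := by
        rw [interp_eq n (by linarith) (by linarith), interp_intCast, hs]
        ring
      refine ⟨?_, e⟩
      rw [← lin_pos (t / N) (by positivity) (by gcongr), add_div]
      apply hadd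
      rw [← add_div, mul_div_cancel₀ _ hN.ne', mul_div_cancel₀ _ hN.ne', mul_div_cancel₀ _ hN.ne',
        e, h.interp_of_mem_Icc ht ht1]
    have down : ∀ (n : ℤ) t, F (n + 1) = F n - η → 0 ≤ t → t ≤ 1 →
        π ((n + 1 - t) / N) = π ((n + 1) / N) + (-p + q * (N * η)) * (t / N) ∧
          interp F (n + 1 - t) = interp F (n + 1) + η * t := by
      intro n t hs ht ht1
      have e : interp F (n + 1 - t) = interp F (n + 1) + η * t := by
        rw [interp_eq n (by linarith) (by linarith), interp_eq n (by linarith) (by linarith), hs]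
        ring
      refine ⟨?_, e⟩
      rw [← lin_neg (t / N) (by positivity) (by gcongr), sub_div, sub_eq_add_neg]
      apply hadd
      rw [← sub_eq_add_neg, ← sub_div, mul_neg, mul_div_cancel₀ _ hN.ne', mul_div_cancel₀ _ hN.ne',
        mul_div_cancel₀ _ hN.ne', e, h.interp_neg_of_mem_Icc ht ht1]
    intro n t ht ht1
    rcases h.step n with hs | hs
    · obtain ⟨e1, e2⟩ := up n t hs ht ht1
      rw [e1, e2]
      field_simp
      ring
    · obtain ⟨e1, e2⟩ := down n (1 - t) hs (by linarith) (by linarith)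
      obtain ⟨e3, e4⟩ := down n 1 hs zero_le_one le_rfl
      rw [show (n : ℝ) + 1 - (1 - t) = n + t by ring] at e1 e2
      rw [add_sub_cancel_right] at e3 e4
      rw [e1, e2, e3, e4]
      field_simp
      ring
  have grid : ∀ n : ℤ, π (n / N) - p * (n / N) - q * interp F n = 0 := by
    intro n
    have hstep : ∀ n : ℤ, π ((n + 1 : ℤ) / N) - p * ((n + 1 : ℤ) / N) - q * interp F (n + 1 : ℤ) =
        π (n / N) - p * (n / N) - q * interp F n := fun n => by
      simpa using cell n 1 zero_le_one le_rfl
    induction n using Int.induction_on with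
    | zero => rw [interp_intCast, h.map_zero, Int.cast_zero, zero_div, h0]; ring
    | succ n ih => exact (hstep n).trans ih
    | pred n ih =>
      rw [← hstep, sub_add_cancel]
      exact ih
  have all : ∀ x, π x = p * x + q * interp F (N * x) := fun x => by
    have e := cell ⌊N * x⌋ (N * x - ⌊N * x⌋) (sub_nonneg.2 (Int.floor_le _))
      (by linarith [Int.lt_floor_add_one (N * x)])
    rw [grid, add_sub_cancel, mul_div_cancel_left₀ _ hN.ne'] at e
    linarith
  have hFN : F N = 0 := by simpa [h.map_zero] using h.periodic 0
  have hFB : F B = 1 := by simpa [h.map_zero] using h.symm 0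
  have hp0 : p = 0 := by
    have := all 1
    rw [mul_one, mul_one, interp_intCast, hFN, h1] at this
    linarith
  have hq1 : q = 1 := by
    have := all b
    rw [hb, interp_intCast, hFB, hb1, hp0] at this
    linarith
  rw [all, hp0, hq1]
  ring

theorem isExtremeFunction (h : IsTwoSlopeGrid N B η F) (hb : N * b = B) :
    IsExtremeFunction (affineLattice b) (fun x => interp F (N * x)) := by
  have hmin := (h.isStronglyMinimal hb).isMinimalCGF
  refine ⟨⟨hmin.1, fun r => h.interp_nonneg _⟩, ?_⟩
  rintro ⟨π₁, π₂, ⟨hc₁, hn₁⟩, ⟨hc₂, hn₂⟩, hne, hmid⟩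
  replace hmid : ∀ r, interp F (N * r) = (π₁ r + π₂ r) / 2 := hmid
  have avg : ∀ {ρ₁ ρ₂ : ℝ → ℝ}, IsCGF (affineLattice b) ρ₁ → IsCGF (affineLattice b) ρ₂ →
      IsCGF (affineLattice b) (fun r => (ρ₁ r + ρ₂ r) / 2) := by
    intro ρ₁ ρ₂ h₁ h₂
    rw [isCGF_iff_multiset] at *
    intro M hM
    rw [Multiset.sum_map_div, Multiset.sum_map_add]
    linarith [h₁ M hM, h₂ M hM]
  have hm₁ : IsMinimalCGF (affineLattice b) π₁ := ⟨hc₁, fun π' hc' hle => by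
    have := hmin.2 _ (avg hc' hc₂) (fun r => le_of_le_of_eq (by linarith [hle r]) (hmid r).symm)
    funext r
    have := congrFun this r
    rw [hmid] at this
    linarith⟩
  have hm₂ : IsMinimalCGF (affineLattice b) π₂ := ⟨hc₂, fun π' hc' hle => by
    have := hmin.2 _ (avg hc₁ hc') (fun r => le_of_le_of_eq (by linarith [hle r]) (hmid r).symm)
    funext r
    have := congrFun this r
    rw [hmid] at this
    linarith⟩
  have hFB : F B = 1 := by simpa [h.map_zero] using h.symm 0
  have hb₁ : π₁ b = 1 := by
    have e := hmid b
    rw [hb, interp_intCast, hFB] at e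
    have := hc₁.one_le_of_mem (self_mem_affineLattice b)
    have := hc₂.one_le_of_mem (self_mem_affineLattice b)
    linarith
  -- Two subadditivity inequalities whose sum is an equality are both equalities.
  have key := h.eq_of_additive hb (π := π₁) (fun u v huv => by
      rw [hmid, hmid, hmid] at huv
      have := hm₁.subadditive u v
      have := hm₂.subadditive u v
      linarith) hn₁ hm₁.map_zero
    (by simpa [hm₁.map_zero] using hm₁.map_add_int 0 1) hb₁
  refine hne (funext fun r => ?_)
  have e1 := key r
  have e2 := hmid r
  linarith

end IsTwoSlopeGrid

/-! ### Symmetric roundings of quasi-periodic functions on the integers -/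

theorem map_add_mul_of_quasiperiodic {R : Type*} [CommRing R] {f : ℤ → R} {N : ℤ} {K : R}
    (hf : ∀ n, f (n + N) = f n + K) (n j : ℤ) : f (n + j * N) = f n + j * K := by
  induction j using Int.induction_on with
  | zero => simp
  | succ j ih =>
    rw [add_one_mul, ← add_assoc, hf, ih]
    push_cast
    ring
  | pred j ih =>
    have := hf (n + (-j - 1) * N)
    rw [show n + (-j - 1) * N + N = n + -j * N by ring, ih] at this
    rw [eq_sub_of_add_eq this.symm]
    push_cast
    ring

/-- Rounding to nearest respects the symmetry except at ties, so one residue of each pair `n`, `B -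
n` modulo `N` rounds ties up and the other rounds them down. Evenness of `H` and `K` makes `g`
integral at self-paired residues, where no such choice is possible. -/
theorem exists_symmetric_rounding {g : ℤ → ℝ} {N B H K : ℤ} (hH : Even H)
    (hK : Even K) (hper : ∀ n, g (n + N) = g n + K) (hsymm : ∀ n, g n + g (B - n) = H) :
    ∃ P : ℤ → ℤ, (∀ n, |P n - g n| ≤ 1 / 2) ∧ (∀ n, P (n + N) = P n + K) ∧
      ∀ n, P n + P (B - n) = H := by
  refine ⟨fun n => if n % N ≤ (B - n) % N then ⌊g n + 1 / 2⌋ else ⌈g n - 1 / 2⌉, ?_, ?_, ?_⟩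
  · intro n
    dsimp only
    rw [abs_le]
    split_ifs
    · have h1 := Int.floor_le (g n + 1 / 2)
      have h2 := Int.lt_floor_add_one (g n + 1 / 2)
      constructor <;> linarith
    · have h1 := Int.le_ceil (g n - 1 / 2)
      have h2 := Int.ceil_lt_add_one (g n - 1 / 2)
      constructor <;> linarith
  · intro n
    have e : (B - (n + N)) % N = (B - n) % N := by
      rw [← sub_sub, Int.sub_emod_right]
    simp only [e, Int.add_emod_right, hper]
    rw [add_right_comm, add_sub_right_comm, Int.floor_add_intCast, Int.ceil_add_intCast]
    split_ifs <;> rfl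
  · intro n
    have hg : g (B - n) = H - g n := by linarith [hsymm n]
    have e1 : ⌈(H : ℝ) - g n - 1 / 2⌉ = H - ⌊g n + 1 / 2⌋ := by
      rw [show (H : ℝ) - g n - 1 / 2 = -(g n + 1 / 2) + H by ring, Int.ceil_add_intCast,
        Int.ceil_neg]
      ring
    have e2 : ⌊(H : ℝ) - g n + 1 / 2⌋ = H - ⌈g n - 1 / 2⌉ := by
      rw [show (H : ℝ) - g n + 1 / 2 = -(g n - 1 / 2) + H by ring, Int.floor_add_intCast,
        Int.floor_neg]
      ring
    simp only [sub_sub_cancel, hg, e1, e2]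
    rcases lt_trichotomy (n % N) ((B - n) % N) with h | h | h
    · rw [if_pos h.le, if_neg h.not_ge]; ring
    -- Here `g (B - n) = g n + j K`, so `2 g n = H - j K` with both terms even.
    · obtain ⟨j, hj⟩ := Int.ModEq.dvd (show n ≡ B - n [ZMOD N] from h)
      have hn : B - n = n + j * N := by linarith [mul_comm N j]
      have hgn := map_add_mul_of_quasiperiodic hper n j
      rw [← hn, hg] at hgn
      obtain ⟨H', rfl⟩ := hH
      obtain ⟨K', rfl⟩ := hK
      have hgi : g n = (H' - j * K' : ℤ) := by
        push_cast at hgn ⊢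
        linarith
      have e3 : ⌊g n + 1 / 2⌋ = H' - j * K' := by
        rw [hgi, Int.floor_eq_iff]
        constructor <;> linarith
      have e4 : ⌈g n - 1 / 2⌉ = H' - j * K' := by
        rw [hgi, Int.ceil_eq_iff]
        constructor <;> linarith
      rw [if_pos h.le, if_pos h.ge, e3, e4]
      ring
    · rw [if_neg h.not_ge, if_pos h.le]; ring

/-! ### The envelope and clamping. -/

/-- The largest `K`-quasi-periodic function with period `N` below `n ↦ max n 0`. -/
def capFun (N K n : ℤ) : ℤ := K * (n / N) + min (n % N) K

/-- Together with `exists_capFun_eq` this gives `capFun N K n = min_j (j K + max (n - j N) 0)`. For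
`N = 2 K`, twice this minus `n` is the distance from `n` to `N ℤ`. -/
theorem capFun_le {N K : ℤ} (hK : 0 < K) (hKN : K ≤ N) (n j : ℤ) :
    capFun N K n ≤ j * K + max (n - j * N) 0 := by
  have hN : 0 < N := hK.trans_le hKN
  have h1 := Int.mul_ediv_add_emod n N
  have h2 := Int.emod_nonneg n hN.ne'
  rw [capFun]
  generalize n / N = q at *
  generalize n % N = r at *
  rcases le_or_gt j q with hjq | hjq
  · have := mul_le_mul_of_nonneg_left hKN (sub_nonneg.2 hjq)
    have := min_le_left r K
    have := le_max_left (n - j * N) 0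
    linarith
  · have := mul_le_mul_of_nonneg_left (Int.add_one_le_iff.2 hjq) hK.le
    have := min_le_right r K
    have := le_max_right (n - j * N) 0
    linarith

theorem exists_capFun_eq {N K : ℤ} (hK : 0 < K) (hKN : K ≤ N) (n : ℤ) :
    ∃ j, capFun N K n = j * K + max (n - j * N) 0 := by
  have hN : 0 < N := hK.trans_le hKN
  have h1 := Int.mul_ediv_add_emod n N
  have h2 := Int.emod_nonneg n hN.ne'
  have h3 := Int.emod_lt_of_pos n hN
  rw [capFun]
  generalize n / N = q at *
  generalize n % N = r at *
  rcases le_total r K with h | h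
  · refine ⟨q, ?_⟩
    rw [min_eq_left h, max_eq_left (by linarith)]
    linarith
  · refine ⟨q + 1, ?_⟩
    rw [min_eq_right h, max_eq_right (by linarith)]
    ring

theorem capFun_add_period {N K : ℤ} (hN : N ≠ 0) (n : ℤ) :
    capFun N K (n + N) = capFun N K n + K := by
  rw [capFun, capFun, Int.add_emod_right, Int.add_ediv_of_dvd_right (dvd_refl N), Int.ediv_self hN]
  ring

theorem capFun_step {N K : ℤ} (hK : 0 < K) (hKN : K ≤ N) (n : ℤ) :
    capFun N K n ≤ capFun N K (n + 1) ∧ capFun N K (n + 1) ≤ capFun N K n + 1 := by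
  obtain ⟨j, hj⟩ := exists_capFun_eq hK hKN n
  obtain ⟨i, hi⟩ := exists_capFun_eq hK hKN (n + 1)
  have h1 := capFun_le hK hKN (n + 1) j
  have h2 := capFun_le hK hKN n i
  omega

theorem capFun_subadditive {N K : ℤ} (hK : 0 < K) (hKN : K ≤ N) (m n : ℤ) :
    capFun N K (m + n) ≤ capFun N K m + capFun N K n := by
  obtain ⟨j, hj⟩ := exists_capFun_eq hK hKN m
  obtain ⟨i, hi⟩ := exists_capFun_eq hK hKN n
  have h1 := capFun_le hK hKN (m + n) (j + i)
  rw [add_mul, add_mul] at h1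
  omega

/-- A shift by `j N` adds exactly `j K` and the remaining shift `n - j N` adds at most its positive
part; the best `j` gives the envelope. Thus subadditivity is automatic wherever one summand is on
the envelope. -/
theorem map_add_le_add_capFun {N K : ℤ} (hK : 0 < K) (hKN : K ≤ N) {h : ℤ → ℤ}
    (step : ∀ n, h n ≤ h (n + 1) ∧ h (n + 1) ≤ h n + 1) (per : ∀ n, h (n + N) = h n + K)
    (m n : ℤ) : h (m + n) ≤ h m + capFun N K n := by
  obtain ⟨j, hj⟩ := exists_capFun_eq hK hKN n
  have hmono : Monotone h := monotone_int_of_le_succ fun n => (step n).1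
  have hlip : ∀ (m : ℤ) (k : ℕ), h (m + k) ≤ h m + k := fun m k => by
    induction k with
    | zero => simp
    | succ k ih =>
      have := (step (m + k)).2
      push_cast
      rw [← add_assoc]
      linarith
  have e := map_add_mul_of_quasiperiodic per (m + (n - j * N)) j
  rw [show m + (n - j * N) + j * N = m + n by ring, Int.cast_id] at e
  have h1 : h (m + (n - j * N)) ≤ h m + max (n - j * N) 0 :=
    calc h (m + (n - j * N)) ≤ h (m + (max (n - j * N) 0).toNat) := hmono (by omega)
      _ ≤ h m + (max (n - j * N) 0).toNat := hlip _ _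
      _ = _ := by omega
  rw [e, hj]
  linarith

/-- Clamping brings the value at `0` down to `0` and keeps steps, quasi-periodicity and symmetry.
The final alternatives record that `h` differs from `P` only where `h` is on the envelope at `n` or
at `B - n`. -/
theorem exists_clamped_function {N K B H : ℤ} (hK : 0 < K) (hN : N = 2 * K)
    (hB : H ≤ capFun N K B) {P : ℤ → ℤ} (hstep : ∀ n, P n ≤ P (n + 1) ∧ P (n + 1) ≤ P n + 1)
    (hper : ∀ n, P (n + N) = P n + K) (hsymm : ∀ n, P n + P (B - n) = H)
    (hsub : ∀ m n, P (m + n) ≤ P m + P n) (h0 : 1 ≤ P 0) (hhalf : ∀ n, n ≤ 2 * P n) :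
    ∃ h : ℤ → ℤ, h 0 = 0 ∧ h 1 = 1 ∧ h (-1) = 0 ∧ (∀ n, h n ≤ h (n + 1) ∧ h (n + 1) ≤ h n + 1) ∧
      (∀ n, h (n + N) = h n + K) ∧ (∀ n, h n + h (B - n) = H) ∧
      (∀ m n, h (m + n) ≤ h m + h n) ∧ (∀ n, n ≤ 2 * h n) ∧
      ∀ n, h n = P n ∨ (h n ≤ P n ∧ ∃ j, 2 * h n = n + |n - j * N|) ∨
        (h (B - n) ≤ P (B - n) ∧ ∃ j, 2 * h (B - n) = (B - n) + |B - n - j * N|) := by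
  have hKN : K ≤ N := by omega
  have hN0 : N ≠ 0 := by omega
  set C := capFun N K with hC
  have Cle : ∀ n j, C n ≤ j * K + max (n - j * N) 0 := capFun_le hK hKN
  have Chalf : ∀ n, ∃ j, 2 * C n = n + |n - j * N| := fun n => by
    obtain ⟨j, hj⟩ := exists_capFun_eq hK hKN n
    refine ⟨j, ?_⟩
    have : j * N = 2 * (j * K) := by rw [hN]; ring
    rcases abs_cases (n - j * N) with ⟨h1, h2⟩ | ⟨h1, h2⟩
    · rw [max_eq_left h2] at hj
      linarith
    · rw [max_eq_right h2.le] at hj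
      linarith
  -- The lower barrier lies below the upper one, by subadditivity of `C` and `H ≤ C B`.
  have AleC : ∀ n, H - C (B - n) ≤ C n := fun n => by
    have := capFun_subadditive hK hKN n (B - n)
    rw [add_sub_cancel] at this
    linarith
  have Cstep : ∀ n, C n ≤ C (n + 1) ∧ C (n + 1) ≤ C n + 1 := capFun_step hK hKN
  have Cper : ∀ n, C (n + N) = C n + K := capFun_add_period hN0
  have hexists : ∃ h : ℤ → ℤ, ∀ n, h n = max (H - C (B - n)) (min (C n) (P n)) := ⟨_, fun _ => rfl⟩
  obtain ⟨h, hh⟩ := hexists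
  have step : ∀ n, h n ≤ h (n + 1) ∧ h (n + 1) ≤ h n + 1 := fun n => by
    have h1 := Cstep n
    have h2 := hstep n
    have h3 := Cstep (B - (n + 1))
    rw [show B - (n + 1) + 1 = B - n by ring] at h3
    have h4 := hh n
    have h5 := hh (n + 1)
    omega
  have per : ∀ n, h (n + N) = h n + K := fun n => by
    have h1 := Cper n
    have h2 := hper n
    have h3 := Cper (B - (n + N))
    rw [show B - (n + N) + N = B - n by ring] at h3
    have h4 := hh n
    have h5 := hh (n + N)
    omega
  have symm : ∀ n, h n + h (B - n) = H := fun n => by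
    have h1 := AleC n
    have h2 := hsymm n
    have h3 := AleC (B - n)
    have h4 := hh n
    have h5 := hh (B - n)
    rw [sub_sub_cancel] at h3 h5
    omega
  have cap : ∀ m n, h (m + n) ≤ h m + C n := map_add_le_add_capFun hK hKN step per
  have C0 : C 0 = 0 := by simp [hC, capFun, hK.le]
  have z0 : h 0 = 0 := by
    have := AleC 0
    have := hh 0
    omega
  refine ⟨h, z0, ?_, ?_, step, per, symm, fun m n => ?_, fun n => ?_, fun n => ?_⟩
  · have h1 : C 1 = 1 := by
      rw [hC, capFun, Int.ediv_eq_zero_of_lt zero_le_one (by omega),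
        Int.emod_eq_of_lt zero_le_one (by omega), min_eq_left (by omega)]
      ring
    have h2 := hh 1
    have h3 := hstep 0
    have h4 := step 0
    rw [zero_add] at h3 h4
    omega
  · have h1 : 0 ≤ C (-1) := by
      obtain ⟨j, hj⟩ := Chalf (-1)
      have := abs_nonneg (-1 - j * N)
      omega
    have h2 := hh (-1)
    have h3 := hstep (-1)
    have h4 := step (-1)
    rw [neg_add_cancel] at h3 h4
    omega
  -- If `h m` or `h n` is on the envelope, `c1` or `c2` suffices. If `h (m + n)` is on the lower
  -- barrier, `c3` and symmetry do. Otherwise `h (m + n) ≤ P (m + n)`, `P m ≤ h m` and `P n ≤ h n`,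
  -- so subadditivity of `P` applies.
  · have hm := hh m
    have hn := hh n
    have hmn := hh (m + n)
    have hP := hsub m n
    have c1 := cap m n
    have c2 := cap n m
    have c3 := cap m (B - (m + n))
    rw [show m + (B - (m + n)) = B - n by ring] at c3
    have s := symm n
    rw [add_comm n m] at c2
    have a1 := AleC m
    have a2 := AleC n
    have a3 := AleC (m + n)
    omega
  · have h1 := hh n
    have h2 := hhalf n
    obtain ⟨j, hj⟩ := Chalf n
    have := abs_nonneg (n - j * N)
    omega
  · have h1 := hh n
    have h2 := hh (B - n)
    have h3 := symm n
    have h4 := hsymm n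
    have h5 := AleC n
    rcases lt_trichotomy (h n) (P n) with hlt | heq | hgt
    · have e : h n = C n := by omega
      exact Or.inr (Or.inl ⟨hlt.le, by rw [e]; exact Chalf n⟩)
    · exact Or.inl heq
    · have e : h (B - n) = C (B - n) := by omega
      exact Or.inr (Or.inr ⟨by omega, by rw [e]; exact Chalf _⟩)

/-- This is where `b = p / q ∉ ℤ` enters: `B = 4 M T p` is at distance at least `4 M T ≥ 2 M` from
the multiples of `N = 4 q M T`, so the envelope leaves room for the value `1` at `b`. -/
theorem le_capFun_of_ne {M T q p : ℤ} (hM : 0 < M) (hT : 0 < T) (hq : 0 < q)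
    (hp : ∀ j, p ≠ j * q) :
    M + 2 * M * T * p ≤ capFun (4 * q * M * T) (2 * q * M * T) (4 * M * T * p) := by
  have hMT : 0 < M * T := mul_pos hM hT
  have hK : 0 < 2 * q * M * T := by positivity
  obtain ⟨j, hj⟩ := exists_capFun_eq hK (N := 4 * q * M * T) (by linarith) (4 * M * T * p)
  rw [hj]
  have h1 : M * 1 ≤ M * T := mul_le_mul_of_nonneg_left hT hM.le
  rcases lt_or_gt_of_ne (hp j) with h | h
  · have h2 : M * T * (p + 1) ≤ M * T * (j * q) := mul_le_mul_of_nonneg_left h hMT.le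
    have h3 := le_max_right (4 * M * T * p - j * (4 * q * M * T)) 0
    linarith
  · have h2 : M * T * (j * q + 1) ≤ M * T * p := mul_le_mul_of_nonneg_left h hMT.le
    have h3 := le_max_left (4 * M * T * p - j * (4 * q * M * T)) 0
    linarith

/-! ### Approximation on a grid, and the theorem. -/

/-- A minimal function whose oscillation over steps of length `4 * M / N` is less than `1 / (2 * M)`
is close, at the points of `(1/N)ℤ`, to a 2-slope function with breakpoints there. -/
theorem exists_isTwoSlopeGrid {b : ℝ} {π : ℝ → ℝ} (hnn : ∀ x, 0 ≤ π x)
    (hsub : ∀ x y, π (x + y) ≤ π x + π y) (hper : ∀ (x : ℝ) (z : ℤ), π (x + z) = π x)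
    (hsymm : ∀ x, π x + π (b - x) = 1) {N K B H M : ℤ} {l : ℝ} (hM : 0 < M) (hK : 0 < K)
    (hl : l ≤ 1) (hMl : 3 ≤ M * l) (hNK : N = 2 * K) (hHB : 2 * H = 2 * M + B)
    (hKe : Even K) (hHe : Even H) (hb : N * b = B) (hcap : H ≤ capFun N K B)
    (hosc : ∀ t : ℝ, |t| * N < 4 * M → π t < 1 / (2 * M)) :
    ∃ F : ℤ → ℝ, IsTwoSlopeGrid N B (1 / (2 * M)) F ∧
      ∀ n : ℤ, |π (n / N) - F n| ≤ l / 2 + 1 / (2 * M) := by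
  have hN : 0 < N := by omega
  have hNr : (0 : ℝ) < N := by exact_mod_cast hN
  have hMr : (1 : ℝ) ≤ M := by exact_mod_cast hM
  have hNKr : (N : ℝ) = 2 * K := by exact_mod_cast hNK
  have hHBr : (2 * H : ℝ) = 2 * M + B := by exact_mod_cast hHB
  have hl0 : 0 < l := by
    by_contra! hneg
    nlinarith
  have hle1 : ∀ x, π x ≤ 1 := fun x => by linarith [hsymm x, hnn (b - x)]
  obtain ⟨ψ, hψ⟩ : ∃ ψ : ℤ → ℝ, ∀ n, ψ n = (1 - l) * π (n / N) + l / 2 := ⟨_, fun _ => rfl⟩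
  have ψper : ∀ n, ψ (n + N) = ψ n := fun n => by
    have := hper (n / N) 1
    rw [hψ, hψ, ← this]
    push_cast
    rw [add_div, div_self hNr.ne']
  have ψsymm : ∀ n, ψ n + ψ (B - n) = 1 := fun n => by
    have := hsymm (n / N)
    rw [hψ, hψ, show ((B - n : ℤ) : ℝ) / N = b - n / N by
      rw [Int.cast_sub, ← hb]; field_simp]
    linear_combination (1 - l) * this
  have ψsub : ∀ m n, ψ (m + n) + l / 2 ≤ ψ m + ψ n := fun m n => by
    have := mul_le_mul_of_nonneg_left (hsub (m / N) (n / N)) (sub_nonneg.2 hl)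
    rw [hψ, hψ, hψ, Int.cast_add, add_div]
    linarith
  have ψge : ∀ n, l / 2 ≤ ψ n := fun n => by
    have := mul_nonneg (sub_nonneg.2 hl) (hnn (n / N))
    rw [hψ]
    linarith
  have ψle : ∀ n, ψ n ≤ 1 := fun n => by linarith [ψsymm n, ψge (B - n)]
  have ψnear : ∀ n : ℤ, |π (n / N) - ψ n| ≤ l / 2 := fun n => by
    have h1 := mul_nonneg hl0.le (hnn (n / N))
    have h2 := mul_le_mul_of_nonneg_left (hle1 (n / N)) hl0.le
    rw [hψ, abs_le]
    constructor <;> linarith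
  have ψstep : ∀ n, |M * (ψ (n + 1) - ψ n)| < 1 / 2 := fun n => by
    have h1 := abs_sub_lt_of_subadditive hsub (δ := 4 * M / N) (ε := 1 / (2 * M))
      (fun t ht => hosc t (by rwa [lt_div_iff₀ hNr] at ht)) ((n + 1 : ℤ) / N) (n / N) (by
        rw [← sub_div, Int.cast_add, add_sub_cancel_left, Int.cast_one, abs_of_pos (by positivity)]
        gcongr
        linarith)
    rw [lt_div_iff₀ (by positivity)] at h1
    rw [hψ, hψ, add_sub_add_right_eq_sub, ← mul_sub, abs_mul, abs_mul,
      abs_of_pos (by linarith : (0 : ℝ) < M), abs_of_nonneg (sub_nonneg.2 hl)]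
    have h2 := abs_nonneg (π ((n + 1 : ℤ) / N) - π (n / N))
    have h3 := mul_nonneg hl0.le (mul_nonneg (by linarith : (0 : ℝ) ≤ M) h2)
    linarith
  -- The term `n / 2` turns steps `±1/2` of `M ψ` into steps `0` or `1`. As `M l / 2 ≥ 3 / 2`, the
  -- slack covers the three rounding errors of `1 / 2` in the subadditivity of `P`.
  obtain ⟨P, hP, Pper, Psymm⟩ := exists_symmetric_rounding (g := fun n => M * ψ n + n / 2)
    (N := N) (B := B) hHe hKe
    (fun n => by rw [ψper]; push_cast; rw [hNKr]; ring)
    (fun n => by push_cast; linear_combination (M : ℝ) * ψsymm n - hHBr / 2)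
  have hP1 : ∀ n, (P n : ℝ) ≤ M * ψ n + n / 2 + 1 / 2 := fun n => by
    linarith [(abs_le.1 (hP n)).2]
  have hP2 : ∀ n, M * ψ n + n / 2 - 1 / 2 ≤ (P n : ℝ) := fun n => by
    linarith [(abs_le.1 (hP n)).1]
  have Mψ : ∀ n, 3 / 2 ≤ M * ψ n := fun n => by
    have := mul_le_mul_of_nonneg_left (ψge n) (by linarith : (0 : ℝ) ≤ M)
    linarith
  have Pstep : ∀ n, P n ≤ P (n + 1) ∧ P (n + 1) ≤ P n + 1 := fun n => by
    have h1 := abs_lt.1 (ψstep n)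
    have h2 := hP1 n
    have h3 := hP2 n
    have h4 := hP1 (n + 1)
    have h5 := hP2 (n + 1)
    push_cast at h4 h5
    have h6 : (P n : ℝ) < (P (n + 1) + 1 : ℤ) := by push_cast; linarith
    have h7 : (P (n + 1) : ℝ) < (P n + 2 : ℤ) := by push_cast; linarith
    have h6 := Int.cast_lt.1 h6
    have h7 := Int.cast_lt.1 h7
    omega
  have Psub : ∀ m n, P (m + n) ≤ P m + P n := fun m n => by
    have h1 := mul_le_mul_of_nonneg_left (ψsub m n) (by linarith : (0 : ℝ) ≤ M)
    have h2 := hP1 (m + n)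
    push_cast at h2
    have h3 : (P (m + n) : ℝ) ≤ (P m + P n : ℤ) := by
      push_cast
      linarith [hP2 m, hP2 n]
    exact_mod_cast h3
  have P0 : 1 ≤ P 0 := by
    have h1 := hP2 0
    have h2 : ((1 : ℤ) : ℝ) ≤ P 0 := by
      push_cast at h1 ⊢
      linarith [Mψ 0]
    exact_mod_cast h2
  have Phalf : ∀ n, n ≤ 2 * P n := fun n => by
    have h2 : (n : ℝ) ≤ (2 * P n : ℤ) := by
      push_cast
      linarith [Mψ n, hP2 n]
    exact_mod_cast h2
  obtain ⟨h, h0, h1, hneg1, step, per, symm, sub, half, htri⟩ :=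
    exists_clamped_function hK hNK hcap Pstep Pper Psymm Psub P0 Phalf
  have hM2 : (0 : ℝ) < 2 * M := by linarith
  obtain ⟨F, hF⟩ : ∃ F : ℤ → ℝ, ∀ n, F n = (2 * h n - n) / (2 * M) := ⟨_, fun _ => rfl⟩
  have Fsymm : ∀ n, F n + F (B - n) = 1 := fun n => by
    have e : (h n + h (B - n) : ℝ) = H := by exact_mod_cast symm n
    rw [hF, hF, ← add_div, div_eq_one_iff_eq hM2.ne']
    push_cast
    linear_combination 2 * e + hHBr
  have Fnonneg : ∀ n, 0 ≤ F n := fun n => by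
    have : (n : ℝ) ≤ 2 * h n := by exact_mod_cast half n
    rw [hF]
    exact div_nonneg (by linarith) hM2.le
  have FleP : ∀ n, h n ≤ P n → F n ≤ ψ n + 1 / (2 * M) := fun n hn => by
    have e : (h n : ℝ) ≤ P n := by exact_mod_cast hn
    rw [hF, div_le_iff₀ hM2, add_mul, div_mul_cancel₀ _ hM2.ne']
    linarith [hP1 n]
  have PleF : ∀ n, P n ≤ h n → ψ n - 1 / (2 * M) ≤ F n := fun n hn => by
    have e : (P n : ℝ) ≤ h n := by exact_mod_cast hn
    rw [hF, le_div_iff₀ hM2, sub_mul, div_mul_cancel₀ _ hM2.ne']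
    linarith [hP2 n]
  -- On the envelope `F n = |n - j N| / (2 M)` is at most `1 + 1 / (2 M)`, so `n / N` is within `4 M
  -- / N` of the integer `j`, where `π` itself is below `1 / (2 M)`.
  have near : ∀ n j : ℤ, h n ≤ P n → 2 * h n = n + |n - j * N| →
      |π (n / N) - F n| ≤ l / 2 + 1 / (2 * M) := by
    intro n j hn hj
    have e1 := FleP n hn
    have hj' : (2 * h n : ℝ) = n + |(n - j * N : ℝ)| := by exact_mod_cast hj
    have e2 : F n = |(n - j * N : ℝ)| / (2 * M) := by rw [hF, hj', add_sub_cancel_left]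
    have e3 : |(n - j * N : ℝ)| < 4 * M := by
      have h1 : F n ≤ 1 + 1 / (2 * M) := e1.trans (by gcongr; exact ψle n)
      rw [e2, div_le_iff₀ hM2, add_mul, div_mul_cancel₀ _ hM2.ne'] at h1
      linarith
    have e4 := hosc (n / N + (-j : ℤ)) (by
      rwa [← abs_of_pos hNr, ← abs_mul, abs_of_pos hNr, add_mul, div_mul_cancel₀ _ hNr.ne',
        Int.cast_neg, neg_mul, ← sub_eq_add_neg])
    rw [hper] at e4
    have e5 := abs_le.1 (ψnear n)
    have e6 := Fnonneg n
    rw [abs_le]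
    constructor <;> linarith
  refine ⟨F, ⟨hN, by positivity, by simp [hF, h0], by simp [hF, h1]; norm_num,
    by simp [hF, hneg1], fun n => ?_, Fnonneg, fun m n => ?_, fun n => ?_, Fsymm⟩, fun n => ?_⟩
  · have : h (n + 1) = h n + 1 ∨ h (n + 1) = h n := by have := step n; omega
    refine this.imp (fun e => ?_) (fun e => ?_)
    · rw [hF, hF, e]
      push_cast
      ring
    · rw [hF, hF, e]
      push_cast
      ring
  · have e : (h (m + n) : ℝ) ≤ h m + h n := by exact_mod_cast sub m n
    rw [hF, hF, hF, ← add_div]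
    push_cast
    gcongr
    linarith
  · rw [hF, hF, per]
    push_cast
    rw [hNKr]
    ring
  · rcases htri n with e | ⟨e, j, hj⟩ | ⟨e, j, hj⟩
    · have e1 := FleP n e.le
      have e2 := PleF n e.ge
      have e3 := abs_le.1 (ψnear n)
      rw [abs_le]
      constructor <;> linarith
    · exact near n j e hj
    · have e1 := near (B - n) j e hj
      rw [show ((B - n : ℤ) : ℝ) / N = b - n / N by
        rw [Int.cast_sub, ← hb]; field_simp] at e1
      have e2 := Fsymm n
      have e3 := hsymm (n / N)
      rw [show π (n / N) - F n = -(π (b - n / N) - F (B - n)) by linarith, abs_neg]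
      exact e1

theorem theorem2 (b : ℚ) (hb : ∀ z : ℤ, b ≠ (z : ℚ))
    (πbar : ℝ → ℝ) (hcont : Continuous πbar)
    (hmin : IsStronglyMinimal (affineLattice (b : ℝ)) πbar)
    (ε : ℝ) (hε : 0 < ε) :
    ∃ πstar : ℝ → ℝ,
      IsExtremeFunction (affineLattice (b : ℝ)) πstar ∧
      IsTwoSlope πstar ∧
      Continuous πstar ∧
      IsStronglyMinimal (affineLattice (b : ℝ)) πstar ∧
      ∀ r : ℝ, |πbar r - πstar r| ≤ ε := by
  have hm := hmin.isMinimalCGF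
  have hnn := hm.nonneg_of_continuous hcont
  obtain ⟨l, hl0, hl1, hlε⟩ : ∃ l : ℝ, 0 < l ∧ l ≤ 1 ∧ l ≤ ε :=
    ⟨min 1 ε, lt_min one_pos hε, min_le_left _ _, min_le_right _ _⟩
  obtain ⟨m, hml⟩ := exists_nat_gt (3 / l)
  have hm0 : (0 : ℝ) < m := lt_trans (by positivity) hml
  rw [div_lt_iff₀ hl0] at hml
  -- `M` is taken even so that `H = M + 2 M T p` is even.
  obtain ⟨M, hMm⟩ : ∃ M : ℤ, M = 2 * m := ⟨_, rfl⟩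
  have hMr : (M : ℝ) = 2 * m := by exact_mod_cast hMm
  have hMl : 3 ≤ M * l := by
    rw [hMr]
    linarith
  have hM : 0 < M := by
    have : (0 : ℝ) < M := by linarith
    exact_mod_cast this
  have hM0 : (0 : ℝ) < M := by exact_mod_cast hM
  obtain ⟨δ, hδ, hosc⟩ := Metric.continuousAt_iff.1 (hcont.continuousAt (x := 0))
    (1 / (2 * M) : ℝ) (by positivity)
  obtain ⟨T, hT⟩ := exists_nat_gt (1 / δ)
  have hT0 : 0 < T := by
    have : (0 : ℝ) < T := lt_trans (by positivity) hT
    exact_mod_cast this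
  rw [div_lt_iff₀ hδ] at hT
  have hq := b.den_pos
  have hq1 : (1 : ℝ) ≤ b.den := by exact_mod_cast hq
  have hTz : (0 : ℤ) < T := by exact_mod_cast hT0
  have hqz : (0 : ℤ) < b.den := by exact_mod_cast hq
  have hbq : (b.den : ℝ) * b = b.num := by exact_mod_cast Rat.den_mul_eq_num b
  -- With `N = 4 q M T`, where `q = b.den`, the length `4 M / N = 1 / (q T)` is at most `1 / T < δ`,
  -- and `N b` is an integer.
  have hosc' : ∀ t : ℝ, |t| * (4 * b.den * M * T : ℤ) < 4 * M → πbar t < 1 / (2 * M) := by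
    intro t ht
    have h1 : |t| < δ := by
      push_cast at ht
      have h2 : |t| * T * b.den < 1 := by
        refine lt_of_mul_lt_mul_left ?_ (by positivity : (0 : ℝ) ≤ 4 * M)
        linarith
      have h3 : |t| * T ≤ |t| * T * b.den := le_mul_of_one_le_right (by positivity) hq1
      have h4 : |t| * T < δ * T := by linarith
      exact lt_of_mul_lt_mul_right h4 (by positivity)
    have h2 := hosc (x := t) (by rwa [Real.dist_eq, sub_zero])
    rw [Real.dist_eq, hm.map_zero, sub_zero] at h2
    exact (le_abs_self _).trans_lt h2
  have hbr : ((4 * b.den * M * T : ℤ) : ℝ) * b = (4 * M * T * b.num : ℤ) := by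
    push_cast
    rw [← hbq]
    ring
  obtain ⟨F, hF, hFnear⟩ := exists_isTwoSlopeGrid (b := b) hnn hm.subadditive
    hm.map_add_int (hm.add_map_sub hnn) (N := 4 * b.den * M * T) (K := 2 * b.den * M * T)
    (B := 4 * M * T * b.num) (H := M + 2 * M * T * b.num) (M := M) (l := l) hM (by positivity) hl1
    hMl (by ring) (by ring) ⟨b.den * M * T, by ring⟩
    ⟨m + M * T * b.num, by rw [hMm]; ring⟩ hbr
    (le_capFun_of_ne hM hTz hqz fun j hj => hb j (by
      rw [← Rat.num_div_den b, hj]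
      push_cast
      exact mul_div_cancel_right₀ _ (by exact_mod_cast hq.ne'))) hosc'
  refine ⟨_, hF.isExtremeFunction hbr, hF.isTwoSlope, hF.continuous, hF.isStronglyMinimal hbr,
    fun r => abs_sub_interp_le ?_ ?_⟩
  all_goals
    have hN := hF.N_pos'
    set N : ℤ := 4 * b.den * M * T
    have h1 := Int.floor_le (N * r)
    have h2 := Int.lt_floor_add_one (N * r)
    generalize ⌊N * r⌋ = n at *
    -- Moving to the grid costs `1 / (2 M) ≤ l / 4` and the grid estimate `l / 2 + 1 / (2 M)`, in
    -- total at most `l ≤ ε`.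
    have hstep : ∀ k : ℤ, |N * r - k| ≤ 1 → |πbar r - F k| ≤ ε := fun k hk => by
      have e1 := abs_sub_lt_of_subadditive hm.subadditive (δ := 4 * M / N) (ε := 1 / (2 * M))
        (fun t ht => hosc' t (by rwa [lt_div_iff₀ hN] at ht)) r (k / N) (by
          rw [lt_div_iff₀ hN, ← abs_of_pos hN, ← abs_mul, abs_of_pos hN, sub_mul,
            div_mul_cancel₀ _ hN.ne', mul_comm]
          have : (1 : ℝ) ≤ M := by exact_mod_cast hM
          linarith)
      have e2 := hFnear k
      have e3 := abs_sub_le (πbar r) (πbar (k / N)) (F k)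
      have e4 : 1 / (2 * M : ℝ) ≤ l / 4 := by
        rw [div_le_div_iff₀ (by positivity) (by norm_num)]
        linarith
      linarith
  · exact hstep n (abs_le.2 ⟨by linarith, by linarith⟩)
  · refine hstep (n + 1) (abs_le.2 ?_)
    push_cast
    constructor <;> linarith
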